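/- All graphs are finite, simple and nonempty. For vertices $u,v$ of a graph $H$ let $d_H(u,v)$ be their distance ($\infty$ if they lie in different components). A set $W\subseteq V(H)$ is a resolving set for $H$ if for any two distinct vertices $u,v$ there is $w\in W$ with $d_H(u,w)\neq d_H(v,w)$; the metric dimension $\beta(H)$ is the least cardinality of a resolving set for $H$ (so $\beta(K_1)=0$). The threshold dimension of a graph $G$ is $\tau(G)=\min\{\beta(H): H \text{ contains } G \text{ as a spanning subgraph}\}$. For real $x\ge 1$ let $f(x)$ be the least integer $d$ such that $2^d+d>x$, and for integers $d\ge 1$ let $\ell_d=2^{d-1}+d-1$. **Theorem.** Let $G$ be a graph of order $n$ with chromatic number $\chi(G)=k$. Then $$\tau(G)\le k\,\bigl(f(n/k)+1\bigr)-1 .$$ Moreover, this bound is sharp for all $k$: for every integer $k\ge 1$ there is a graph $G$ with $\chi(G)=k$ for which equality holds, where $n$ is the order of $G$. For every $k\ge 2$ equality holds for an infinite family of complete $k$-partite graphs: if $d\ge 1$ is any integer with $\ell_{d+1}-\ell_d>k$ (which holds for all sufficiently large $d$), then the complete $k$-partite graph $K_{x_1,\dots,x_k}$ with $x_1=\ell_d+1$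 and $x_2=\dots=x_k=\ell_{d+1}+1$ has chromatic number $k$ and, with $n=x_1+\dots+x_k$, satisfies $$\tau(K_{x_1,\dots,x_k})=k\,\bigl(f(n/k)+1\bigr)-1 .$$ -/

import Mathlib

namespace ThresholdDimension

/-- `W` is a resolving set for `G`: every pair of distinct vertices is resolved by some `w ∈ W`.
Distances are extended distances: vertices in different components are at distance `⊤`. -/
def IsResolving {V : Type*} (G : SimpleGraph V) (W : Finset V) : Prop :=
  ∀ u v : V, u ≠ v → ∃ w ∈ W, G.edist u w ≠ G.edist v w

/-- The metric dimension `β(G)` of a finite graph: the least cardinality of a resolving set. -/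
noncomputable def metricDim {V : Type*} (G : SimpleGraph V) : ℕ :=
  sInf {m : ℕ | ∃ W : Finset V, IsResolving G W ∧ W.card = m}

/-- The threshold dimension `τ(G)` of a finite graph: the least metric dimension of a graph `H`
having `G` as a spanning subgraph. -/
noncomputable def thresholdDim {V : Type*} (G : SimpleGraph V) : ℕ :=
  sInf {m : ℕ | ∃ H : SimpleGraph V, G ≤ H ∧ metricDim H = m}

/-- `f x` is the least integer `d` with `2 ^ d + d > x`. It is used for `x ≥ 1` only, where the
least such integer is positive. -/
noncomputable def f (x : ℝ) : ℕ :=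
  sInf {d : ℕ | (2 : ℝ) ^ d + d > x}

/-- `ℓ d = 2 ^ (d - 1) + d - 1` for `d ≥ 1`: the least number that `f` maps to `d`. -/
def ell (d : ℕ) : ℕ := 2 ^ (d - 1) + (d - 1)

/-- The sizes of the `k` parts: the first one is `ℓ d + 1`, all others are `ℓ (d + 1) + 1`. -/
def sharpSize (k d : ℕ) (i : Fin k) : ℕ :=
  if (i : ℕ) = 0 then ell d + 1 else ell (d + 1) + 1

/-- The complete `k`-partite graph with parts of sizes `sharpSize k d`. -/
abbrev sharpGraph (k d : ℕ) : SimpleGraph (Σ i : Fin k, Fin (sharpSize k d i)) :=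
  SimpleGraph.completeMultipartiteGraph fun i : Fin k => Fin (sharpSize k d i)

end ThresholdDimension

namespace ThresholdDimension

open Finset

/-! Colour `G` with classes of sizes `x i` and join all vertices of different classes. In each class
take `f (x i)` landmarks and label the other vertices by distinct proper subsets of them, used as
neighbourhoods. Labels separate within a class; properness separates across classes. So `τ ≤ ∑ f (x
i)` (`thresholdDim_le_sum_f`), and convexity of `ell` bounds this sum by the mean
(`sum_f_add_one_le`).

Conversely, above a complete multipartite graph only landmarks in a class can separate its
non-landmarks, and only by adjacency, so `w` of them serve at most `2 ^ w + w` vertices. If no class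
size has that exact form, `τ = ∑ f (x i)`; the sharp sizes make this sum meet the bound. -/

/-! ### Arithmetic of `f` and convexity -/

theorem f_le_iff (x : ℝ) (j : ℕ) : f x ≤ j ↔ x < 2 ^ j + j := by
  have hne : {d : ℕ | (2 : ℝ) ^ d + d > x}.Nonempty := by
    obtain ⟨m, hm⟩ := exists_nat_gt x
    refine ⟨m, ?_⟩
    have : (0 : ℝ) < 2 ^ m := by positivity
    simp only [Set.mem_ofPred_eq]
    linarith
  refine ⟨fun h => ?_, fun h => Nat.sInf_le h⟩
  have h1 : (2 : ℝ) ^ f x + f x > x := Nat.sInf_mem hne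
  have h2 : (2 : ℝ) ^ f x ≤ 2 ^ j := pow_le_pow_right₀ (by norm_num) h
  have h3 : (f x : ℝ) ≤ j := by exact_mod_cast h
  linarith

theorem f_natCast_le_iff (x j : ℕ) : f (x : ℝ) ≤ j ↔ x < 2 ^ j + j := by
  rw [f_le_iff]
  exact_mod_cast Iff.rfl

theorem f_natCast_le_self (x : ℕ) : f (x : ℝ) ≤ x := by
  rw [f_natCast_le_iff]
  have : 0 < 2 ^ x := by positivity
  omega

/-- The function `ell` is convex, so it lies above each of its chords. -/
theorem chord_le (x e : ℕ) :
    2 ^ (e + 1) + (e + 1) + f (x : ℝ) * (2 ^ e + 1) ≤ x + (e + 2) * (2 ^ e + 1) := by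
  rcases hf : f (x : ℝ) with _ | m
  · have : 0 < 2 ^ e := by positivity
    rw [pow_succ]
    nlinarith
  · have hx : 2 ^ m + m ≤ x := by
      by_contra! h
      have := (f_natCast_le_iff x m).2 h
      omega
    -- For `m = e + t` this is `t + 1 ≤ 2 ^ t`, scaled by `2 ^ e`.
    have hm : (m + 1) * 2 ^ e ≤ 2 ^ m + e * 2 ^ e := by
      rcases lt_or_ge m e with h | h
      · have : (m + 1) * 2 ^ e ≤ e * 2 ^ e := Nat.mul_le_mul_right _ h
        exact this.trans (Nat.le_add_left _ _)
      · obtain ⟨t, rfl⟩ := Nat.exists_eq_add_of_le h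
        have ht : t < 2 ^ t := Nat.lt_two_pow_self
        have : 0 < 2 ^ e := by positivity
        rw [pow_add]
        nlinarith
    rw [pow_succ]
    nlinarith

/-- With `f (n / k) = e + 1`, sum the chord through `ell (e + 1)` and `ell (e + 2)` over all
classes: a sum of at least `k * (e + 2)` would force `n ≥ k * ell (e + 2)`. -/
theorem sum_f_add_one_le {k : ℕ} (hk : 0 < k) (x : Fin k → ℕ) (hx : k ≤ ∑ i, x i) :
    ∑ i, f (x i : ℝ) + 1 ≤ k * (f (((∑ i, x i : ℕ) : ℝ) / (k : ℝ)) + 1) := by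
  set n := ∑ i, x i with hn
  have hk' : (0 : ℝ) < k := by exact_mod_cast hk
  have hd : n < k * (2 ^ f ((n : ℝ) / k) + f ((n : ℝ) / k)) := by
    have h := (f_le_iff ((n : ℝ) / k) _).1 le_rfl
    rw [div_lt_iff₀' hk'] at h
    exact_mod_cast h
  rcases he : f ((n : ℝ) / k) with _ | e
  · rw [he] at hd
    simp at hd
    omega
  · rw [he] at hd
    have hsum := sum_le_sum fun i (_ : i ∈ (univ : Finset (Fin k))) => chord_le (x i) e
    simp only [sum_add_distrib, sum_const, card_univ, Fintype.card_fin, smul_eq_mul,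
      ← sum_mul, ← hn] at hsum
    by_contra! h
    have h1 : k * (e + 2) ≤ ∑ i, f (x i : ℝ) := by
      have : k * (e + 1 + 1) = k * (e + 2) := by ring
      omega
    have h2 := Nat.mul_le_mul_right (2 ^ e + 1) h1
    nlinarith

/-! ### Resolving sets: upper and lower bounds by class sizes -/

section Resolving

variable {V : Type*}

theorem isResolving_univ [Fintype V] (H : SimpleGraph V) : IsResolving H univ := fun u v huv =>
  ⟨u, mem_univ _, by
    rw [SimpleGraph.edist_self]
    exact (SimpleGraph.edist_pos_of_ne huv.symm).ne⟩

theorem IsResolving.of_adj {H : SimpleGraph V} {W : Finset V}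
    (h : ∀ u v : V, u ∉ W → v ∉ W → u ≠ v → ∃ w ∈ W, ¬(H.Adj u w ↔ H.Adj v w)) :
    IsResolving H W := by
  intro u v huv
  by_cases hu : u ∈ W
  · exact ⟨u, hu, by
      rw [SimpleGraph.edist_self]
      exact (SimpleGraph.edist_pos_of_ne huv.symm).ne⟩
  by_cases hv : v ∈ W
  · exact ⟨v, hv, by
      rw [SimpleGraph.edist_self]
      exact (SimpleGraph.edist_pos_of_ne huv).ne'⟩
  obtain ⟨w, hw, hne⟩ := h u v hu hv huv
  refine ⟨w, hw, fun heq => hne ?_⟩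
  rw [← SimpleGraph.edist_eq_one_iff_adj, ← SimpleGraph.edist_eq_one_iff_adj, heq]

theorem thresholdDim_le {G H : SimpleGraph V} {W : Finset V} (hGH : G ≤ H)
    (hW : IsResolving H W) : thresholdDim G ≤ #W :=
  have h1 : thresholdDim G ≤ metricDim H := Nat.sInf_le ⟨H, hGH, rfl⟩
  have h2 : metricDim H ≤ #W := Nat.sInf_le ⟨W, hW, rfl⟩
  h1.trans h2

theorem le_thresholdDim [Fintype V] {G : SimpleGraph V} {m : ℕ}
    (h : ∀ (H : SimpleGraph V) (W : Finset V), G ≤ H → IsResolving H W → m ≤ #W) :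
    m ≤ thresholdDim G := by
  refine le_csInf (Set.nonempty_of_mem ⟨G, le_rfl, rfl⟩) ?_
  rintro _ ⟨H, hGH, rfl⟩
  refine le_csInf (Set.nonempty_of_mem ⟨univ, isResolving_univ H, rfl⟩) ?_
  rintro _ ⟨W, hW, rfl⟩
  exact h H W hGH hW

/-- A finite set of fewer than `2 ^ d + d` elements has a `d`-subset `W` such that its other
elements can be labelled by distinct proper subsets of `W`. -/
theorem exists_labelling [DecidableEq V] (C : Finset V) {d : ℕ} (hd : d ≤ #C)
    (hC : #C < 2 ^ d + d) :
    ∃ W ⊆ C, #W = d ∧ ∃ φ : V → Finset V, Set.InjOn φ ↑(C \ W) ∧ ∀ v ∈ C \ W, φ v ⊂ W := by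
  obtain ⟨W, hWC, hW⟩ := exists_subset_card_eq hd
  refine ⟨W, hWC, hW, ?_⟩
  -- Excluding `W` itself leaves `2 ^ d - 1` labels, whence the strict inequality in `hC`.
  have hcard : Fintype.card ↥(C \ W) ≤ Fintype.card ↥W.ssubsets := by
    rw [Fintype.card_coe, Fintype.card_coe, ssubsets, card_erase_of_mem (mem_powerset_self W), card_powerset,
      card_sdiff_of_subset hWC, hW]
    omega
  obtain ⟨g⟩ := Function.Embedding.nonempty_of_card_le hcard
  refine ⟨fun v => if h : v ∈ C \ W then (g ⟨v, h⟩ : Finset V) else ∅, ?_, ?_⟩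
  · intro u hu v hv huv
    rw [mem_coe] at hu hv
    simp only [hu, hv, dif_pos] at huv
    exact congrArg Subtype.val (g.injective (Subtype.ext huv))
  · intro v hv
    simp only [hv, dif_pos]
    exact mem_ssubsets.1 (g ⟨v, hv⟩).2

theorem thresholdDim_le_sum_f [Fintype V] {k : ℕ} (G : SimpleGraph V) (c : V → Fin k)
    (hc : ∀ u v, G.Adj u v → c u ≠ c v) :
    thresholdDim G ≤ ∑ i, f ((#{v | c v = i} : ℕ) : ℝ) := by
  classical
  have hex (i : Fin k) := exists_labelling {v | c v = i}
    (f_natCast_le_self #{v | c v = i}) ((f_natCast_le_iff _ _).1 le_rfl)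
  choose W hWC hW φ hinj hss using hex
  have hWc {i : Fin k} {w : V} (hw : w ∈ W i) : c w = i := by simpa using hWC i hw
  have hsd {u : V} (hu : u ∉ univ.biUnion W) :
      u ∈ ({v | c v = c u} : Finset V) \ W (c u) := by
    simp only [mem_biUnion, mem_univ, true_and, not_exists] at hu
    simpa using hu (c u)
  -- `φ` is uncontrolled on landmarks; restricting `u` keeps the symmetrization in `fromRel` from
  -- giving non-landmarks extra landmark neighbours.
  let r : V → V → Prop := fun u w => c u ≠ c w ∨ u ∉ univ.biUnion W ∧ w ∈ φ (c u) u
  have hφW {u w : V} (hu : u ∉ univ.biUnion W) (hw : w ∈ φ (c u) u) : w ∈ univ.biUnion W :=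
    mem_biUnion.2 ⟨c u, mem_univ _, (hss _ _ (hsd hu)).1 hw⟩
  let H : SimpleGraph V := SimpleGraph.fromRel r
  have hadj {u w : V} (hu : u ∉ univ.biUnion W) (hw : w ∈ univ.biUnion W) :
      H.Adj u w ↔ c u ≠ c w ∨ w ∈ φ (c u) u := by
    have hne : u ≠ w := by
      rintro rfl
      exact hu hw
    simp only [H, r, SimpleGraph.fromRel_adj, hne, hu, hw, ne_eq, not_false_eq_true, true_and,
      not_true_eq_false, false_and, or_false, eq_comm (a := c w)]
    tauto
  have hres : IsResolving H (univ.biUnion W) := by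
    refine IsResolving.of_adj fun u v hu hv huv => ?_
    by_cases hcuv : c u = c v
    · have hne : φ (c u) u ≠ φ (c u) v := fun h =>
        huv (hinj (c u) (mem_coe.2 (hsd hu)) (mem_coe.2 (hcuv ▸ hsd hv)) h)
      obtain ⟨w, hw⟩ : ∃ w, ¬(w ∈ φ (c u) u ↔ w ∈ φ (c u) v) := by
        by_contra! h
        exact hne (Finset.ext h)
      have hwW : w ∈ W (c u) := by
        by_contra hw'
        have h1 : w ∉ φ (c u) u := fun h => hw' ((hss _ _ (hsd hu)).1 h)
        have h2 : w ∉ φ (c u) v := fun h => hw' ((hss _ _ (hcuv ▸ hsd hv)).1 h)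
        tauto
      have hwU := mem_biUnion.2 ⟨c u, mem_univ _, hwW⟩
      refine ⟨w, hwU, ?_⟩
      rw [hadj hu hwU, hadj hv hwU, hWc hwW, ← hcuv]
      simpa using hw
    -- By properness `u` misses some landmark of its own class, while `v` is adjacent to all of
    -- them.
    · obtain ⟨w, hwW, hw⟩ := exists_of_ssubset (hss _ _ (hsd hu))
      have hwU := mem_biUnion.2 ⟨c u, mem_univ _, hwW⟩
      refine ⟨w, hwU, ?_⟩
      rw [hadj hu hwU, hadj hv hwU, hWc hwW]
      have : c v ≠ c u := fun h => hcuv h.symm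
      tauto
  have hGH : G ≤ H := fun u v huv =>
    (SimpleGraph.fromRel_adj _ _ _).2 ⟨huv.ne, Or.inl (Or.inl (hc u v huv))⟩
  calc thresholdDim G ≤ #(univ.biUnion W) := thresholdDim_le hGH hres
    _ ≤ ∑ i, #(W i) := card_biUnion_le
    _ = _ := sum_congr rfl fun i _ => hW i

theorem thresholdDim_add_one_le [Fintype V] [Nonempty V] (G : SimpleGraph V) (k : ℕ)
    (hG : G.chromaticNumber = k) :
    thresholdDim G + 1 ≤ k * (f ((Fintype.card V : ℝ) / (k : ℝ)) + 1) := by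
  obtain ⟨C⟩ : G.Colorable k := SimpleGraph.chromaticNumber_le_iff_colorable.1 hG.le
  have hk : 0 < k := by
    have := (C (Classical.arbitrary V)).pos
    omega
  have hkn : k ≤ Fintype.card V := by
    have h := G.chromaticNumber_le_card
    rw [hG] at h
    exact_mod_cast h
  have hsum : ∑ i, #{v | C v = i} = Fintype.card V :=
    (card_eq_sum_card_fiberwise fun v _ => mem_coe.2 (mem_univ (C v))).symm
  have h1 := thresholdDim_le_sum_f G C fun u v huv => C.valid huv
  have h2 := sum_f_add_one_le hk (fun i => #{v | C v = i}) (by rw [hsum]; exact hkn)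
  rw [hsum] at h2
  omega

/-- In a supergraph of a complete multipartite graph, the landmarks in a part separate the other
vertices of that part by adjacency. -/
theorem card_fiber_le_of_isResolving [Fintype V] {k : ℕ} {H : SimpleGraph V} {W : Finset V}
    (c : V → Fin k) (hH : ∀ u v, c u ≠ c v → H.Adj u v) (hW : IsResolving H W) {i : Fin k}
    (z : V) (hz : c z ≠ i) :
    #{v | c v = i} ≤ 2 ^ #{w ∈ W | c w = i} + #{w ∈ W | c w = i} := by
  classical
  set Wi : Finset V := {w ∈ W | c w = i}
  have hsub : Wi ⊆ ({v | c v = i} : Finset V) := fun w hw => by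
    simpa using (mem_filter.1 hw).2
  have hle : #(({v | c v = i} : Finset V) \ Wi) ≤ #Wi.powerset := by
    refine card_le_card_of_injOn (fun u => {w ∈ Wi | H.Adj u w})
      (fun u _ => mem_coe.2 (mem_powerset.2 (filter_subset _ _))) ?_
    intro u hu v hv huv
    by_contra hne
    obtain ⟨w, hw, hd⟩ := hW u v hne
    have key {t : V} (ht : t ∈ (↑(({v | c v = i} : Finset V) \ Wi) : Set V)) :
        c t = i ∧ t ∉ W := by
      simp only [Wi, coe_sdiff, coe_filter, mem_univ, true_and, Set.mem_sdiff,
        Set.mem_ofPred_eq] at ht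
      tauto
    obtain ⟨hcu, huW⟩ := key hu
    obtain ⟨hcv, hvW⟩ := key hv
    -- `z`, in another class, is a common neighbour, so distances within the class never exceed 2.
    have two {t : V} (hct : c t = i) (htW : t ∉ W) (hcw : c w = i) (hadj : ¬H.Adj t w) :
        H.edist t w = 2 :=
      SimpleGraph.edist_eq_two_iff.2 ⟨fun h => htW (h ▸ hw), hadj, z,
        hH _ _ (by rw [hct]; exact hz.symm), hH _ _ (by rw [hcw]; exact hz.symm)⟩
    by_cases hcw : c w = i
    · have hiff : H.Adj u w ↔ H.Adj v w := by
        have := Finset.ext_iff.1 huv w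
        simpa [Wi, hw, hcw] using this
      by_cases ha : H.Adj u w
      · rw [SimpleGraph.edist_eq_one_iff_adj.2 ha,
          SimpleGraph.edist_eq_one_iff_adj.2 (hiff.1 ha)] at hd
        exact hd rfl
      · rw [two hcu huW hcw ha, two hcv hvW hcw (fun h => ha (hiff.2 h))] at hd
        exact hd rfl
    · rw [SimpleGraph.edist_eq_one_iff_adj.2 (hH u w (by rw [hcu]; exact Ne.symm hcw)),
        SimpleGraph.edist_eq_one_iff_adj.2 (hH v w (by rw [hcv]; exact Ne.symm hcw))] at hd
      exact hd rfl
  rw [card_powerset, card_sdiff_of_subset hsub] at hle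
  omega

theorem sum_f_le_thresholdDim [Fintype V] {k : ℕ} (hk : 2 ≤ k) (G : SimpleGraph V)
    (c : V → Fin k) (hc : Function.Surjective c) (hG : ∀ u v, c u ≠ c v → G.Adj u v)
    (hsize : ∀ i j, #{v | c v = i} ≠ 2 ^ j + j) :
    ∑ i, f ((#{v | c v = i} : ℕ) : ℝ) ≤ thresholdDim G := by
  refine le_thresholdDim fun H W hGH hW => ?_
  rw [card_eq_sum_card_fiberwise (s := W) (t := univ) (f := c)
    fun v _ => mem_coe.2 (mem_univ (c v))]
  refine sum_le_sum fun i _ => ?_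
  have : Nontrivial (Fin k) := Fin.nontrivial_iff_two_le.2 hk
  obtain ⟨j, hj⟩ := exists_ne i
  obtain ⟨z, rfl⟩ := hc j
  rw [f_natCast_le_iff]
  exact (card_fiber_le_of_isResolving c (fun u v h => hGH (hG u v h)) hW z hj).lt_of_ne
    (hsize _ _)

end Resolving

/-! ### Graphs attaining the bound -/

section Sharp

variable {V : Type*}

theorem f_eq_of_ell {x d : ℕ} (h1 : ell (d + 1) ≤ x) (h2 : x < ell (d + 2)) :
    f (x : ℝ) = d + 1 := by
  simp only [ell, Nat.add_sub_cancel, show d + 2 - 1 = d + 1 by omega] at h1 h2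
  apply le_antisymm
  · rwa [f_natCast_le_iff]
  · by_contra! h
    have := (f_natCast_le_iff x d).1 (by omega)
    omega

theorem ne_of_ell {x d : ℕ} (h1 : ell (d + 1) < x) (h2 : x < ell (d + 2)) (j : ℕ) :
    x ≠ 2 ^ j + j := by
  simp only [ell, Nat.add_sub_cancel, show d + 2 - 1 = d + 1 by omega] at h1 h2
  rintro rfl
  rcases Nat.lt_or_ge d j with h | h
  · have := Nat.pow_le_pow_right (n := 2) (by norm_num) (Nat.succ_le_of_lt h)
    simp only [Nat.succ_eq_add_one] at this
    omega
  · have := Nat.pow_le_pow_right (n := 2) (by norm_num) h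
    omega

theorem ell_succ_succ (d : ℕ) : ell (d + 2) = ell (d + 1) + 2 ^ d + 1 := by
  simp only [ell, Nat.add_sub_cancel, show d + 2 - 1 = d + 1 by omega, pow_succ]
  omega

/-- A graph with the part sizes `sharpSize k d` attains the upper bound. -/
theorem thresholdDim_eq_of_sharpSize [Fintype V] {k d : ℕ} (hk : 2 ≤ k) (hd : 1 ≤ d)
    (hkd : ell d + k < ell (d + 1)) (G : SimpleGraph V) (c : V → Fin k)
    (hG : ∀ u v, G.Adj u v ↔ c u ≠ c v) (hsize : ∀ i, #{v | c v = i} = sharpSize k d i) :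
    G.chromaticNumber = k ∧
      thresholdDim G + 1 = k * (f ((Fintype.card V : ℝ) / (k : ℝ)) + 1) := by
  obtain ⟨e, rfl⟩ := Nat.exists_eq_add_of_le' hd
  have hc : Function.Surjective c := fun i => by
    have hpos : 0 < #{v | c v = i} := by
      rw [hsize, sharpSize]
      split_ifs <;> omega
    obtain ⟨v, hv⟩ := card_pos.1 hpos
    exact ⟨v, by simpa using hv⟩
  have h1 : ell (e + 1 + 1) = ell (e + 2) := rfl
  have h2 := ell_succ_succ (e + 1)
  have hpow : 0 < 2 ^ (e + 1) := by positivity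
  have hf (i : Fin k) : f ((#{v | c v = i} : ℕ) : ℝ) = if (i : ℕ) = 0 then e + 1 else e + 2 := by
    rw [hsize, sharpSize]
    split_ifs
    · exact f_eq_of_ell (by omega) (by omega)
    · exact f_eq_of_ell (d := e + 1) (by omega) (by omega)
  have hne (i : Fin k) (j : ℕ) : #{v | c v = i} ≠ 2 ^ j + j := by
    rw [hsize, sharpSize]
    split_ifs
    · exact ne_of_ell (d := e) (by omega) (by omega) j
    · exact ne_of_ell (d := e + 1) (by omega) (by omega) j
  have hcol : G.Colorable k :=
    ⟨SimpleGraph.Coloring.mk c fun {u v} huv => (hG u v).1 huv⟩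
  have hchrom : G.chromaticNumber = k := by
    refine le_antisymm hcol.chromaticNumber_le ?_
    obtain ⟨s, hs⟩ := hc.hasRightInverse
    refine SimpleGraph.le_chromaticNumber_of_pairwise_adj (by simp) s fun i j hij => ?_
    simpa only [hG, hs i, hs j] using hij
  refine ⟨hchrom, ?_⟩
  obtain ⟨m, rfl⟩ := Nat.exists_eq_add_of_le' (show 1 ≤ k by omega)
  have : Nonempty V := ⟨(hc 0).choose⟩
  have hlow := sum_f_le_thresholdDim hk G c hc (fun u v h => (hG u v).2 h) hne
  have hup := thresholdDim_add_one_le G _ hchrom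
  have hcard : Fintype.card V = (ell (e + 1) + 1) + m * (ell (e + 2) + 1) := by
    have hsum : ∑ i, #{v | c v = i} = Fintype.card V :=
      (card_eq_sum_card_fiberwise fun v _ => mem_coe.2 (mem_univ (c v))).symm
    rw [← hsum]
    simp [hsize, Fin.sum_univ_succ, sharpSize]
  have hsumf : ∑ i, f ((#{v | c v = i} : ℕ) : ℝ) = (e + 1) + m * (e + 2) := by
    simp [hf, Fin.sum_univ_succ]
  -- Here `n < k * ell (d + 1)` is equivalent to `hkd`; it brings the upper bound down to the sum in
  -- `hsumf`.
  have hfn : f ((Fintype.card V : ℝ) / ((m + 1 : ℕ) : ℝ)) ≤ e + 1 := by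
    have hell : ell (e + 2) = 2 ^ (e + 1) + (e + 1) := rfl
    have hlt : Fintype.card V < (m + 1) * (2 ^ (e + 1) + (e + 1)) := by
      rw [hcard, ← hell]
      have hkd' : ell (e + 1) + (m + 1) < ell (e + 2) := hkd
      nlinarith
    rw [f_le_iff, div_lt_iff₀' (by positivity)]
    exact_mod_cast hlt
  have hmul := Nat.mul_le_mul_left (m + 1) (Nat.add_le_add_right hfn 1)
  have : (m + 1) * (e + 1 + 1) = (e + 1) + m * (e + 2) + 1 := by ring
  omega

theorem card_fiber_sigma_fst {k : ℕ} (s : Fin k → ℕ) (i : Fin k) :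
    #{v : Σ i : Fin k, Fin (s i) | v.1 = i} = s i := by
  have : ({v : Σ i : Fin k, Fin (s i) | v.1 = i} : Finset _) =
      (univ : Finset (Fin (s i))).map (Function.Embedding.sigmaMk i) := by
    ext ⟨j, a⟩
    simp only [mem_filter, mem_univ, true_and, mem_map, Function.Embedding.sigmaMk_apply]
    constructor
    · rintro rfl
      exact ⟨a, rfl⟩
    · rintro ⟨b, hb⟩
      exact (congrArg Sigma.fst hb).symm
  rw [this, card_map, card_univ, Fintype.card_fin]

theorem exists_sharp_graph {k : ℕ} (hk : 1 ≤ k) :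
    ∃ (n : ℕ) (G : SimpleGraph (Fin n)), 1 ≤ n ∧ G.chromaticNumber = k ∧
      thresholdDim G + 1 = k * (f ((n : ℝ) / (k : ℝ)) + 1) := by
  rcases hk.eq_or_lt with rfl | hk
  · have hchrom : (⊥ : SimpleGraph (Fin 2)).chromaticNumber = (1 : ℕ) := by
      simpa using SimpleGraph.chromaticNumber_bot (V := Fin 2)
    refine ⟨2, ⊥, by norm_num, hchrom, ?_⟩
    have hup := thresholdDim_add_one_le (⊥ : SimpleGraph (Fin 2)) 1 hchrom
    have hlow : 1 ≤ thresholdDim (⊥ : SimpleGraph (Fin 2)) :=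
      le_thresholdDim fun H W _ hW => by
        obtain ⟨w, hw, -⟩ := hW 0 1 (by decide)
        exact card_pos.2 ⟨w, hw⟩
    have hf : f (((2 : ℕ) : ℝ)) ≤ 1 := by
      rw [f_natCast_le_iff]
      norm_num
    simp only [Fintype.card_fin, Nat.cast_one, div_one] at hup ⊢
    omega
  -- With `d = k + 1` the gap is `2 ^ k + 1 > k`.
  · have hkd : ell (k + 1) + k < ell (k + 2) := by
      have := ell_succ_succ k
      have : k < 2 ^ k := Nat.lt_two_pow_self
      omega
    let φ := Fintype.equivFin (Σ i : Fin k, Fin (sharpSize k (k + 1) i))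
    have h := thresholdDim_eq_of_sharpSize hk (by omega) hkd
      ((sharpGraph k (k + 1)).comap φ.symm) (fun v => (φ.symm v).1) (fun u v => by simp)
      (fun i => by
        rw [← card_fiber_sigma_fst (sharpSize k (k + 1)) i]
        refine card_equiv φ.symm fun v => ?_
        simp)
    refine ⟨_, (sharpGraph k (k + 1)).comap φ.symm, ?_, h.1, ?_⟩
    · exact Fintype.card_pos_iff.2 ⟨⟨⟨0, by omega⟩, ⟨0, by simp [sharpSize]⟩⟩⟩
    · simpa only [Fintype.card_fin] using h.2

end Sharp

end ThresholdDimension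

theorem mainTheorem1 :
    -- the upper bound
    (∀ (V : Type*) [Fintype V] [Nonempty V] (G : SimpleGraph V) (n k : ℕ),
      Fintype.card V = n → G.chromaticNumber = k →
      (ThresholdDimension.thresholdDim G : ℤ) ≤
        (k : ℤ) * ((ThresholdDimension.f ((n : ℝ) / (k : ℝ)) : ℤ) + 1) - 1) ∧
    -- it is attained for every `k ≥ 1`
    (∀ k : ℕ, 1 ≤ k → ∃ (n : ℕ) (G : SimpleGraph (Fin n)),
      1 ≤ n ∧ G.chromaticNumber = k ∧
      (ThresholdDimension.thresholdDim G : ℤ) =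
        (k : ℤ) * ((ThresholdDimension.f ((n : ℝ) / (k : ℝ)) : ℤ) + 1) - 1) ∧
    -- and for every `k ≥ 2` by an explicit infinite family of complete `k`-partite graphs,
    -- one for each `d ≥ 1` with `ℓ (d + 1) - ℓ d > k`
    (∀ k : ℕ, 2 ≤ k → ∀ d : ℕ, 1 ≤ d →
      ThresholdDimension.ell d + k < ThresholdDimension.ell (d + 1) →
      (ThresholdDimension.sharpGraph k d).chromaticNumber = k ∧
      (ThresholdDimension.thresholdDim (ThresholdDimension.sharpGraph k d) : ℤ) =
        (k : ℤ) * ((ThresholdDimension.f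
          ((Fintype.card (Σ i : Fin k, Fin (ThresholdDimension.sharpSize k d i)) : ℝ) /
            (k : ℝ)) : ℤ) + 1) - 1) := by
  refine ⟨?_, ?_, ?_⟩
  · rintro V _ _ G n k rfl hG
    have h := ThresholdDimension.thresholdDim_add_one_le G k hG
    zify at h
    linarith
  · intro k hk
    obtain ⟨n, G, hn, hG, h⟩ := ThresholdDimension.exists_sharp_graph hk
    refine ⟨n, G, hn, hG, ?_⟩
    zify at h
    linarith
  · intro k hk d hd hkd
    obtain ⟨hG, h⟩ := ThresholdDimension.thresholdDim_eq_of_sharpSize hk hd hkd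
      (ThresholdDimension.sharpGraph k d) Sigma.fst (fun u v => by simp)
      (ThresholdDimension.card_fiber_sigma_fst _)
    refine ⟨hG, ?_⟩
    zify at h
    linarith
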